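/- **Setting.** Let $a^*=3/\bigl(2(26+15\sqrt3)\bigr)^{1/3}$, let $0<a<a^*$ (the range in which the self-similar marginally bound Lemaître–Tolman–Bondi spacetime has a naked singularity), and let $L\in\{0,1,2,\dots\}$ (the angular number). Put $$S(z)=(1+az)^{2/3},\qquad q(z)=\frac{a^2}{6\pi(3+4az+a^2z^2)},\qquad h(z)=z+S-z\dot S,\qquad \dot{}=\frac{d}{dz},$$ and let the Cauchy horizon $z_c$ be the largest zero of $h$ in $(-1/a,0)$. Let $$\tilde A=\mathrm{diag}\Bigl(0,0,-\tfrac1z,-\tfrac{1}{z-S+z\dot S},-\tfrac{1}{z+S-z\dot S}\Bigr),$$ let $\tilde C=(c_{ij})$ be the $5\times5$ matrix with $c_{23}=c_{42}=c_{52}=0$ and $$c_{11}=\frac{-3z(-1+\dot S)\dot S^2-S^2\ddot S+S\bigl(3\dot S^2-z\ddot S+\dot S(-3+2z\ddot S)\bigr)}{S(-1+\dot S)(S-z\dot S)},\quad c_{12}=-\frac{-1+\dot S}{2S},\quad c_{13}=c_{14}=c_{15}=\frac{-1+\dot S}{2S},$$ $$c_{21}=-\frac{8\pi qS}{-1+\dot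 S},\quad c_{22}=-\frac{\dot q}{q},\quad c_{24}=-\frac{4\pi qS}{1+\dot S},\quad c_{25}=-\frac{4\pi qS}{-1+\dot S},$$ $$c_{31}=\frac{n_1}{zS(-1+\dot S)(S-z\dot S)^2},\quad c_{32}=-\frac2z-\frac{\dot q}{q},\quad c_{33}=\frac1z+\frac{2\dot S}{S},\quad c_{34}=\frac{n_2}{2zS(1+\dot S)},\quad c_{35}=\frac{n_3}{2zS(-1+\dot S)},$$ $$c_{41}=\frac{4(1+\dot S)(-z\dot S^2+S(\dot S+z\ddot S))}{S(-1+\dot S)(z-S+z\dot S)},\quad c_{43}=c_{45}=\frac{(1+\dot S)(S-z\dot S)}{S(z-S+z\dot S)},\quad c_{44}=\frac{3+(z+S)\ddot S+\dot S(3+z\ddot S)}{(1+\dot S)(z-S+z\dot S)},$$ $$c_{51}=-\frac{4(-z\dot S^2+S(\dot S+z\ddot S))}{S(z+S-z\dot S)},\quad c_{53}=c_{54}=-\frac{(-1+\dot S)(S-z\dot S)}{S(z+S-z\dot S)},\quad c_{55}=-\frac{3+(-z+S)\ddot S+\dot S(-3+z\ddot S)}{(-1+\dot S)(z+S-z\dot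 S)},$$ where $$n_1=2\bigl(2z^3\dot S^4-2z^2S\dot S^2(3\dot S+z\ddot S)+S^3(-2\dot S+z^2S^{(3)})+zS^2(6\dot S^2+z^2\ddot S^2+z\dot S(2\ddot S-zS^{(3)}))\bigr),$$ $$n_2=z\dot S(2-L-L^2+2\dot S+2\dot S^2)-4S^2\ddot S+S\bigl(-2+L+L^2-2\dot S^2-2z\ddot S+\dot S(-2+4z\ddot S)\bigr),$$ $$n_3=z\dot S(-2+L+L^2+2\dot S-2\dot S^2)+4S^2\ddot S-S\bigl(-2+L+L^2-2\dot S^2+2z\ddot S+\dot S(2+4z\ddot S)\bigr),$$ and let $$\vec\varphi=\Bigl(0,\;0,\;-\frac{16\pi q(-S+z\dot S)}{zS},\;-\frac{8\pi q(1+\dot S)(S-z\dot S)}{S(z-S+z\dot S)},\;\frac{8\pi q(-1+\dot S)(S-z\dot S)}{S(z+S-z\dot S)}\Bigr)^{T}.$$ With $z=z_c+t$ put $A(t)=t\tilde A(z)$, $C(t)=t\tilde C(z)$, $\vec\Sigma(t,p)=t\,\vec\varphi(z)\,g(p)$, and let $c=\lim_{t\to0^+}t\,c_{55}(z_c+t)$,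 i.e. the limit at the horizon of the $(5,5)$ entry of $C(t)$. **Statement.** Let $0<t_1<-z_c$ (so that all coefficients are regular on $(0,t_1]$), $\vec f\in C_0^\infty(\mathbb R,\mathbb R^5)$ and $g\in C_0^\infty(\mathbb R,\mathbb R)$. Then there are constants $\beta_1,\dots,\beta_5$, depending only on $a$, $L$, $t_1$ and the initial data $\vec f,g$, such that for every smooth solution $\vec u(t,p)$ on $(0,t_1]\times\mathbb R$ of $$t\,\frac{\partial\vec u}{\partial t}+A(t)\frac{\partial\vec u}{\partial p}+C(t)\vec u=\vec\Sigma(t,p),\qquad \vec u(t_1,\cdot)=\vec f,$$ the rescaled perturbation $\vec x=t^c\vec u$ is uniformly bounded up to the Cauchy horizon $t=0$: for all $t\in(0,t_1]$ and $p\in\mathbb R$, $$|x_i(t,p)|\le\beta_i\quad(i=1,\dots,4),\qquad |t^{1/2}x_5(t,p)|\le\beta_5 .$$ -/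

import Mathlib

open Set Filter Topology
open scoped ContDiff

noncomputable section

namespace LTB

/-- The radial function `S(z) = (1 + a z)^{2/3}` of the self-similar marginally bound
Lemaitre-Tolman-Bondi spacetime; it is used only where `1 + a z > 0`. -/
def radial (a z : ℝ) : ℝ := (1 + a * z) ^ ((2 : ℝ) / 3)

/-- The first, second and third derivatives of the radial function with respect to `z`. -/
def radial1 (a z : ℝ) : ℝ := deriv (radial a) z
def radial2 (a z : ℝ) : ℝ := iteratedDeriv 2 (radial a) z
def radial3 (a z : ℝ) : ℝ := iteratedDeriv 3 (radial a) z

/-- The dust density function `q(z)`. -/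
def density (a z : ℝ) : ℝ :=
  a ^ 2 / (6 * Real.pi * (3 + 4 * a * z + a ^ 2 * z ^ 2))

/-- The function `h(z) = z + S - z S'`, whose zeros are the outgoing radial null rays `z = const`. -/
def horizonFn (a z : ℝ) : ℝ := z + radial a z - z * radial1 a z

/-- The bound `a^*` on the parameter `a` below which the singularity is naked. -/
def aStar : ℝ := 3 / (2 * (26 + 15 * √3)) ^ ((1 : ℝ) / 3)

/-- The Cauchy horizon `z = z_c`: the first root of `h` that is met when `z` decreases from `0`
towards the shell-focusing singularity at `z = -1/a`. (For `0 < a < a^*` the set is finite and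
nonempty, so that the supremum is its greatest element.) -/
def cauchyHorizon (a : ℝ) : ℝ := sSup {z : ℝ | -1 / a < z ∧ z < 0 ∧ horizonFn a z = 0}

/-- The diagonal of the matrix `Ã(z)`. -/
def aTilde (a z : ℝ) : Fin 5 → ℝ :=
  ![0,
    0,
    -(1 / z),
    -(z - radial a z + z * radial1 a z)⁻¹,
    -(z + radial a z - z * radial1 a z)⁻¹]

/-- The matrix `C̃(z)` for the multipole mode with angular number `l`. -/
def cTilde (a : ℝ) (l : ℕ) (z : ℝ) : Matrix (Fin 5) (Fin 5) ℝ :=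
  let S := radial a z
  let S1 := radial1 a z
  let S2 := radial2 a z
  let S3 := radial3 a z
  let q := density a z
  let q1 := deriv (density a) z
  let π := Real.pi
  let L : ℝ := l
  let n1 : ℝ := 2 * (2 * z ^ 3 * S1 ^ 4 - 2 * z ^ 2 * S * S1 ^ 2 * (3 * S1 + z * S2)
    + S ^ 3 * (-2 * S1 + z ^ 2 * S3)
    + z * S ^ 2 * (6 * S1 ^ 2 + z ^ 2 * S2 ^ 2 + z * S1 * (2 * S2 - z * S3)))
  let n2 : ℝ := z * S1 * (2 - L - L ^ 2 + 2 * S1 + 2 * S1 ^ 2) - 4 * S ^ 2 * S2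
    + S * (-2 + L + L ^ 2 - 2 * S1 ^ 2 - 2 * z * S2 + S1 * (-2 + 4 * z * S2))
  let n3 : ℝ := z * S1 * (-2 + L + L ^ 2 + 2 * S1 - 2 * S1 ^ 2) + 4 * S ^ 2 * S2
    - S * (-2 + L + L ^ 2 - 2 * S1 ^ 2 + 2 * z * S2 + S1 * (2 + 4 * z * S2))
  let c11 : ℝ := (-3 * z * (-1 + S1) * S1 ^ 2 - S ^ 2 * S2
    + S * (3 * S1 ^ 2 - z * S2 + S1 * (-3 + 2 * z * S2))) / (S * (-1 + S1) * (S - z * S1))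
  let c12 : ℝ := -((-1 + S1) / (2 * S))
  let c13 : ℝ := (-1 + S1) / (2 * S)
  let c14 : ℝ := (-1 + S1) / (2 * S)
  let c15 : ℝ := (-1 + S1) / (2 * S)
  let c21 : ℝ := -(8 * π * q * S / (-1 + S1))
  let c22 : ℝ := -(q1 / q)
  let c24 : ℝ := -(4 * π * q * S / (1 + S1))
  let c25 : ℝ := -(4 * π * q * S / (-1 + S1))
  let c31 : ℝ := n1 / (z * S * (-1 + S1) * (S - z * S1) ^ 2)
  let c32 : ℝ := -(2 / z) - q1 / q
  let c33 : ℝ := 1 / z + 2 * S1 / S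
  let c34 : ℝ := n2 / (2 * z * S * (1 + S1))
  let c35 : ℝ := n3 / (2 * z * S * (-1 + S1))
  let c41 : ℝ := 4 * (1 + S1) * (-z * S1 ^ 2 + S * (S1 + z * S2))
    / (S * (-1 + S1) * (z - S + z * S1))
  let c43 : ℝ := (1 + S1) * (S - z * S1) / (S * (z - S + z * S1))
  let c44 : ℝ := (3 + (z + S) * S2 + S1 * (3 + z * S2)) / ((1 + S1) * (z - S + z * S1))
  let c45 : ℝ := (1 + S1) * (S - z * S1) / (S * (z - S + z * S1))
  let c51 : ℝ := -(4 * (-z * S1 ^ 2 + S * (S1 + z * S2)) / (S * (z + S - z * S1)))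
  let c53 : ℝ := -((-1 + S1) * (S - z * S1) / (S * (z + S - z * S1)))
  let c54 : ℝ := -((-1 + S1) * (S - z * S1) / (S * (z + S - z * S1)))
  let c55 : ℝ := -((3 + (-z + S) * S2 + S1 * (-3 + z * S2)) / ((-1 + S1) * (z + S - z * S1)))
  !![c11, c12, c13, c14, c15;
     c21, c22, 0,   c24, c25;
     c31, c32, c33, c34, c35;
     c41, 0,   c43, c44, c45;
     c51, 0,   c53, c54, c55]

/-- The `z`-dependent factor of the source, `Σ₅(z,p) = sourceTilde(z) g(p)`. -/
def sourceTilde (a z : ℝ) : Fin 5 → ℝ :=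
  let S := radial a z
  let S1 := radial1 a z
  let q := density a z
  let π := Real.pi
  ![0,
    0,
    -(16 * π * q * (-S + z * S1) / (z * S)),
    -(8 * π * q * (1 + S1) * (S - z * S1) / (S * (z - S + z * S1))),
    8 * π * q * (-1 + S1) * (S - z * S1) / (S * (z + S - z * S1))]

/-- The coefficients in terms of the time coordinate `t = z - z_c`:
`A(t) = t Ã(z)` (a diagonal matrix), `C(t) = t C̃(z)` and `Σ(t,p) = t Σ₅(z,p)`. -/
def coeffA (a t : ℝ) : Matrix (Fin 5) (Fin 5) ℝ :=
  t • Matrix.diagonal (aTilde a (cauchyHorizon a + t))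

def coeffC (a : ℝ) (l : ℕ) (t : ℝ) : Matrix (Fin 5) (Fin 5) ℝ :=
  t • cTilde a l (cauchyHorizon a + t)

def source (a : ℝ) (g : ℝ → ℝ) (t p : ℝ) : Fin 5 → ℝ :=
  (t * g p) • sourceTilde a (cauchyHorizon a + t)

/-- The exponent `c`: the limit at the Cauchy horizon of the `(5,5)` entry
`t (3 + (S - z) S'' + S' (-3 + z S'')) / ((1 - S') (z + S - z S'))`, `z = z_c + t`, of `C(t)`.
The entry does not involve `l`. -/
def exponent (a : ℝ) : ℝ :=
  limUnder (𝓝[>] (0 : ℝ)) fun t =>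
    let z := cauchyHorizon a + t
    t * ((3 + (radial a z - z) * radial2 a z + radial1 a z * (-3 + z * radial2 a z))
      / ((1 - radial1 a z) * (z + radial a z - z * radial1 a z)))

open Matrix in
/-- `u = u(t,p)` is a smooth solution on `(0,t₁] × ℝ` of the initial value problem
`t ∂u/∂t + A(t) ∂u/∂p + C(t) u = Σ(t,p)`, `u(t₁,·) = f`. The time derivative is one-sided at `t₁`. -/
structure IsSolution (a : ℝ) (l : ℕ) (t₁ : ℝ) (g : ℝ → ℝ) (f : ℝ → Fin 5 → ℝ)
    (u : ℝ → ℝ → Fin 5 → ℝ) : Prop where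
  smooth : ContDiffOn ℝ ∞ (fun y : ℝ × ℝ => u y.1 y.2) (Ioc 0 t₁ ×ˢ univ)
  eqn : ∀ t ∈ Ioc 0 t₁, ∀ p : ℝ,
    t • derivWithin (fun s => u s p) (Ioc 0 t₁) t + coeffA a t *ᵥ deriv (fun r => u t r) p
      + coeffC a l t *ᵥ u t p = source a g t p
  init : ∀ p : ℝ, u t₁ p = f p

/-- The rescaled perturbation `x = t^c u`. -/
def rescaled (a : ℝ) (u : ℝ → ℝ → Fin 5 → ℝ) (t p : ℝ) : Fin 5 → ℝ :=
  t ^ exponent a • u t p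

end LTB

end

/-! The point z_c is a simple zero of h, so h(z_c + t) is comparable to t. Hence the first four rows
of C̃ stay bounded, while the fifth is O(1/t) with diagonal entry c/t + O(1) (`exists_coeff_bound`).
Each component obeys an ordinary differential equation along its own characteristic, and the speeds,
even the unbounded -1/h, do not enter a supremum bound. So it suffices to find w_i(t) with -w_i' > ∑
|c_ij| w_j + |source_i| that dominate the data at t₁ (`abs_lt_of_strict_supersolution`).

Such w_i are B e^{-mt} t^{-c} for i ≤ 4 and B e^{-mt} t^{-c-1/2} for i = 5 (`barrier_strict`). In
the fifth row the extra half power gains a term of order t^{-c-3/2}, which beats the forcing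
O(t^{-c-1}) by the other components. In the first four rows the fifth component contributes only
O(t^{-c-1/2}), beaten by the c t^{-c-1} that differentiating t^{-c} produces; this needs c > 0
(`exponent_pos`). A large m covers t away from 0. Multiplication by t^c or t^{c+1/2} leaves the
bound B, independent of the solution. -/

/-- A comparison principle for diagonal first-order hyperbolic systems solved backwards in time:
a strict supersolution of the majorant system bounds the solution on a domain of dependence. -/
theorem abs_lt_of_strict_supersolution {ι : Type*} [Fintype ι]
    {u : ℝ → ℝ → ι → ℝ} {b : ℝ → ι → ℝ} {C : ℝ → Matrix ι ι ℝ} {src : ℝ → ℝ → ι → ℝ}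
    {w w' : ℝ → ι → ℝ} {t₀ t₁ M : ℝ} (h01 : t₀ ≤ t₁)
    (hu : ∀ i, ContinuousOn (fun y : ℝ × ℝ => u y.1 y.2 i) (Icc t₀ t₁ ×ˢ univ))
    (hb : ∀ s ∈ Ico t₀ t₁, ∀ i, |b s i| ≤ M)
    (hdir : ∀ s ∈ Ico t₀ t₁, ∀ p i,
      HasDerivAt (fun τ => u (s + τ) (p + τ * b s i) i) (src s p i - ∑ j, C s i j * u s p j) 0)
    (hw : ∀ s ∈ Icc t₀ t₁, ∀ i, HasDerivAt (fun s => w s i) (w' s i) s)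
    (hlt : ∀ s ∈ Ico t₀ t₁, ∀ p i, (∑ j, |C s i j| * w s j) + |src s p i| < -w' s i)
    (hinit : ∀ p i, |u t₁ p i| < w t₁ i) (p₀ : ℝ) (i₀ : ι) :
    |u t₀ p₀ i₀| < w t₀ i₀ := by
  by_contra! hcon
  have hM : 0 ≤ M ∨ t₁ ≤ t₀ := by
    rcases lt_or_ge t₀ t₁ with h | h
    · exact Or.inl ((abs_nonneg _).trans (hb t₀ ⟨le_rfl, h⟩ i₀))
    · exact Or.inr h
  have hM : 0 ≤ M := by
    rcases hM with h | h
    · exact h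
    · obtain rfl := le_antisymm h01 h
      exact absurd (hinit p₀ i₀) (not_lt.2 hcon)
  -- The cone opening towards later times from (t₀, p₀); lines of slope at most M that start in it
  -- remain in it. It makes the search for touching points compact.
  set D : Set (ℝ × ℝ) := {y | y.1 ∈ Icc t₀ t₁ ∧ |y.2 - p₀| ≤ M * (y.1 - t₀)} with hD
  have hDc : IsCompact D := by
    refine ((isCompact_Icc (a := t₀) (b := t₁)).prod (isCompact_Icc (a := p₀ - M * (t₁ - t₀))
      (b := p₀ + M * (t₁ - t₀)))).of_isClosed_subset ?_ ?_
    · refine IsClosed.inter ?_ ?_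
      · exact isClosed_Icc.preimage continuous_fst
      · exact (isClosed_le (f := fun y : ℝ × ℝ => |y.2 - p₀|) (g := fun y => M * (y.1 - t₀))
          (by fun_prop) (by fun_prop) :)
    · rintro ⟨s, p⟩ ⟨h1, h2⟩
      have : M * (s - t₀) ≤ M * (t₁ - t₀) := mul_le_mul_of_nonneg_left (by linarith [h1.2]) hM
      simp only at h2
      have h3 := abs_le.1 (h2.trans this)
      exact ⟨h1, by constructor <;> linarith [h3.1, h3.2]⟩
  have hDs : D ⊆ Icc t₀ t₁ ×ˢ univ := fun y hy => ⟨hy.1, mem_univ _⟩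
  have hfc : ∀ i, ContinuousOn (fun y : ℝ × ℝ => w y.1 i - |u y.1 y.2 i|) D := fun i => by
    refine ContinuousOn.sub ?_ ((hu i).mono hDs).abs
    intro y hy
    exact ((hw y.1 hy.1 i).continuousAt.comp (f := Prod.fst) continuousAt_fst).continuousWithinAt
  set E : Set (ℝ × ℝ) := ⋃ i, D ∩ (fun y : ℝ × ℝ => w y.1 i - |u y.1 y.2 i|) ⁻¹' Iic 0 with hE
  have hEc : IsCompact E := isCompact_iUnion fun i =>
    hDc.of_isClosed_subset ((hfc i).preimage_isClosed_of_isClosed hDc.isClosed isClosed_Iic)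
      inter_subset_left
  have hEne : E.Nonempty := ⟨(t₀, p₀), mem_iUnion.2 ⟨i₀, ⟨⟨le_rfl, h01⟩, by simp⟩, by
    simpa using hcon⟩⟩
  -- The latest point of the cone where some component violates its bound: strictly later points of
  -- the cone satisfy all the bounds strictly.
  obtain ⟨⟨s, p⟩, hsp, hmax⟩ := hEc.exists_isMaxOn hEne continuous_fst.continuousOn
  obtain ⟨i, ⟨hs, hp⟩, hi⟩ := mem_iUnion.1 hsp
  simp only [mem_preimage, mem_Iic, sub_nonpos] at hi hs hp
  have hst : s < t₁ := by
    rcases hs.2.lt_or_eq with h | rfl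
    · exact h
    · exact absurd (hinit p i) (not_lt.2 hi)
  have hgood : ∀ s' p', s < s' → s' ≤ t₁ → |p' - p₀| ≤ M * (s' - t₀) →
      ∀ j, |u s' p' j| < w s' j := by
    intro s' p' h1 h2 h3 j
    by_contra! h4
    have h5 : (s', p') ∈ E :=
      mem_iUnion.2 ⟨j, ⟨⟨hs.1.trans h1.le, h2⟩, h3⟩, by simpa using h4⟩
    exact absurd (hmax h5) (not_le.2 h1)
  have hnear : ∀ᶠ τ in 𝓝[>] (0 : ℝ), 0 < τ ∧ s + τ ≤ t₁ := by
    filter_upwards [Ioo_mem_nhdsGT (sub_pos.2 hst)] with τ hτ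
    exact ⟨hτ.1, by linarith [hτ.2]⟩
  have hdirgood : ∀ k : ℝ, |k| ≤ M → ∀ᶠ τ in 𝓝[>] (0 : ℝ),
      ∀ j, |u (s + τ) (p + τ * k) j| < w (s + τ) j := by
    intro k hk
    filter_upwards [hnear] with τ hτ
    refine hgood _ _ (by linarith [hτ.1]) hτ.2 ?_
    calc |p + τ * k - p₀| = |(p - p₀) + τ * k| := by ring_nf
      _ ≤ |p - p₀| + |τ * k| := abs_add_le _ _
      _ ≤ M * (s - t₀) + τ * M := by
        rw [abs_mul, abs_of_pos hτ.1]
        exact add_le_add hp (mul_le_mul_of_nonneg_left hk hτ.1.le)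
      _ = _ := by ring
  have hsI : s ∈ Ico t₀ t₁ := ⟨hs.1, hst⟩
  have hwshift : ∀ j, HasDerivAt (fun τ => w (s + τ) j) (w' s j) 0 := fun j => by
    have := hw s hs j
    rw [← add_zero s] at this
    simpa using this.comp_const_add s 0
  -- Limit from later times along the characteristic of component j.
  have hle : ∀ j, |u s p j| ≤ w s j := by
    intro j
    have h1 : Tendsto (fun τ => |u (s + τ) (p + τ * b s j) j|) (𝓝[>] 0) (𝓝 |u s p j|) := by
      have := (hdir s hsI p j).continuousAt.tendsto.mono_left
        (nhdsWithin_le_nhds (s := Ioi (0 : ℝ)))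
      simpa using this.abs
    have h2 : Tendsto (fun τ => w (s + τ) j) (𝓝[>] 0) (𝓝 (w s j)) := by
      have := (hwshift j).continuousAt.tendsto.mono_left
        (nhdsWithin_le_nhds (s := Ioi (0 : ℝ)))
      simpa using this
    exact le_of_tendsto_of_tendsto h1 h2 ((hdirgood _ (hb s hsI j)).mono fun τ hτ => (hτ j).le)
  have hieq : |u s p i| = w s i := le_antisymm (hle i) hi
  obtain ⟨σ, hσ, hσu⟩ : ∃ σ : ℝ, |σ| = 1 ∧ σ * u s p i = |u s p i| := by
    rcases abs_cases (u s p i) with h | h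
    · exact ⟨1, by simp, by rw [h.1, one_mul]⟩
    · exact ⟨-1, by simp, by rw [h.1]; ring⟩
  have hder := ((hdir s hsI p i).const_mul σ).sub (hwshift i)
  -- Along the i-th characteristic σ u_i - w_i vanishes at (s, p) and has positive derivative, so it
  -- becomes positive at later times, where it must be negative.
  have hpos : 0 < σ * (src s p i - ∑ j, C s i j * u s p j) - w' s i := by
    have h1 : |σ * (src s p i - ∑ j, C s i j * u s p j)| ≤
        (∑ j, |C s i j| * w s j) + |src s p i| := by
      rw [abs_mul, hσ, one_mul]
      refine (abs_sub _ _).trans ?_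
      rw [add_comm]
      gcongr
      refine (Finset.abs_sum_le_sum_abs _ _).trans (Finset.sum_le_sum fun j _ => ?_)
      rw [abs_mul]
      exact mul_le_mul_of_nonneg_left (hle j) (abs_nonneg _)
    have h2 := hlt s hsI p i
    have h3 := neg_abs_le (σ * (src s p i - ∑ j, C s i j * u s p j))
    linarith
  have hslope := (hasDerivAt_iff_tendsto_slope.1 hder).mono_left
    (nhdsWithin_mono (0 : ℝ) (s := Ioi 0) (fun x hx => ne_of_gt hx))
  have hev := hslope.eventually (lt_mem_nhds hpos)
  obtain ⟨τ, hτ, hτ0, hτu⟩ := (hev.and (hnear.and (hdirgood _ (hb s hsI i)))).exists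
  rw [slope_def_field] at hτ
  have h0 : σ * u (s + 0) (p + 0 * b s i) i - w (s + 0) i = 0 := by
    simp only [add_zero, zero_mul]; rw [hσu, hieq, sub_self]
  have h1 : σ * u (s + τ) (p + τ * b s i) i - w (s + τ) i < 0 := by
    have := le_abs_self (σ * u (s + τ) (p + τ * b s i) i)
    rw [abs_mul, hσ, one_mul] at this
    linarith [hτu i]
  simp only [Pi.sub_apply] at hτ
  rw [h0, sub_zero, sub_zero] at hτ
  exact absurd hτ (not_lt.2 (div_neg_of_neg_of_pos h1 hτ0.1).le)

/-! ### Analyticity, closed forms and monotonicity of S and h. -/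

namespace LTB

theorem analyticAt_radial {a z : ℝ} (h : 0 < 1 + a * z) : AnalyticAt ℝ (radial a) z := by
  have h1 : ContDiffAt ℝ ω (fun z : ℝ => 1 + a * z) z := by fun_prop
  exact (h1.rpow_const_of_ne h.ne').analyticAt

theorem analyticAt_radial1 {a z : ℝ} (h : 0 < 1 + a * z) : AnalyticAt ℝ (radial1 a) z :=
  (analyticAt_radial h).deriv

theorem radial2_eq (a : ℝ) : radial2 a = deriv (radial1 a) := by
  funext z
  rw [radial2, iteratedDeriv_succ, iteratedDeriv_one]
  rfl

theorem radial3_eq (a : ℝ) : radial3 a = deriv (radial2 a) := by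
  funext z
  rw [radial3, iteratedDeriv_succ]
  rfl

theorem analyticAt_radial2 {a z : ℝ} (h : 0 < 1 + a * z) : AnalyticAt ℝ (radial2 a) z := by
  rw [radial2_eq]; exact (analyticAt_radial1 h).deriv

theorem analyticAt_radial3 {a z : ℝ} (h : 0 < 1 + a * z) : AnalyticAt ℝ (radial3 a) z := by
  rw [radial3_eq]; exact (analyticAt_radial2 h).deriv

theorem analyticAt_horizonFn {a z : ℝ} (h : 0 < 1 + a * z) : AnalyticAt ℝ (horizonFn a) z := by
  have h1 := analyticAt_radial h
  have h2 := analyticAt_radial1 h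
  unfold horizonFn
  fun_prop

theorem radial_pos {a z : ℝ} (h : 0 < 1 + a * z) : 0 < radial a z := Real.rpow_pos_of_pos h _

theorem hasDerivAt_one_add_mul (a z : ℝ) : HasDerivAt (fun z : ℝ => 1 + a * z) a z := by
  simpa using ((hasDerivAt_id z).const_mul a).const_add 1

theorem radial1_eq_rpow {a z : ℝ} (h : 0 < 1 + a * z) :
    radial1 a z = 2 / 3 * a * (1 + a * z) ^ (-(1 : ℝ) / 3) := by
  rw [radial1, show radial a = fun z => (1 + a * z) ^ ((2 : ℝ) / 3) from rfl,
    ((hasDerivAt_one_add_mul a z).rpow_const (p := 2 / 3) (Or.inl h.ne')).deriv]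
  rw [show (2 : ℝ) / 3 - 1 = -1 / 3 by norm_num]
  ring

theorem radial2_eq_rpow {a z : ℝ} (h : 0 < 1 + a * z) :
    radial2 a z = -(2 / 9 * a ^ 2) * (1 + a * z) ^ (-(4 : ℝ) / 3) := by
  have hev : radial1 a =ᶠ[𝓝 z] fun z => 2 / 3 * a * (1 + a * z) ^ (-(1 : ℝ) / 3) := by
    have : ∀ᶠ y in 𝓝 z, 0 < 1 + a * y :=
      (hasDerivAt_one_add_mul a z).continuousAt.eventually (lt_mem_nhds h)
    exact this.mono fun y hy => radial1_eq_rpow hy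
  rw [radial2_eq, hev.deriv_eq, (((hasDerivAt_one_add_mul a z).rpow_const (p := -1 / 3)
    (Or.inl h.ne')).const_mul (2 / 3 * a)).deriv]
  rw [show (-1 : ℝ) / 3 - 1 = -4 / 3 by norm_num]
  ring

theorem radial1_pos {a z : ℝ} (ha : 0 < a) (h : 0 < 1 + a * z) : 0 < radial1 a z := by
  rw [radial1_eq_rpow h]
  have := Real.rpow_pos_of_pos h (-(1 : ℝ) / 3)
  positivity

theorem radial1_antitone {a y z : ℝ} (ha : 0 < a) (h : 0 < 1 + a * y) (hyz : y ≤ z) :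
    radial1 a z ≤ radial1 a y := by
  have h1 : 1 + a * y ≤ 1 + a * z := by gcongr
  rw [radial1_eq_rpow h, radial1_eq_rpow (h.trans_le h1)]
  gcongr 2 / 3 * a * ?_
  exact Real.rpow_le_rpow_of_nonpos h h1 (by norm_num)

theorem hasDerivAt_horizonFn {a z : ℝ} (h : 0 < 1 + a * z) :
    HasDerivAt (horizonFn a) (1 - z * radial2 a z) z := by
  have h1 : HasDerivAt (radial a) (radial1 a z) z :=
    (analyticAt_radial h).differentiableAt.hasDerivAt
  have h2 : HasDerivAt (radial1 a) (radial2 a z) z := by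
    rw [radial2_eq]; exact (analyticAt_radial1 h).differentiableAt.hasDerivAt
  refine HasDerivAt.congr_deriv (((hasDerivAt_id z).add h1).sub ((hasDerivAt_id z).mul h2)) ?_
  simp only [id_eq]
  ring

/-- Convexity of h on (-1/a, 0]: z S'' is a multiple of |z| (1 + az)^{-4/3}, and both factors
decrease in z. This is what excludes a double zero at the horizon. -/
theorem deriv_horizonFn_monotone {a y z : ℝ} (h : 0 < 1 + a * y) (ha : 0 < a)
    (hyz : y ≤ z) (hz : z ≤ 0) : 1 - y * radial2 a y ≤ 1 - z * radial2 a z := by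
  have h1 : 1 + a * y ≤ 1 + a * z := by gcongr
  rw [radial2_eq_rpow h, radial2_eq_rpow (h.trans_le h1)]
  have h2 : (1 + a * z) ^ (-(4 : ℝ) / 3) ≤ (1 + a * y) ^ (-(4 : ℝ) / 3) :=
    Real.rpow_le_rpow_of_nonpos h h1 (by norm_num)
  have h3 : 0 < (1 + a * z) ^ (-(4 : ℝ) / 3) := Real.rpow_pos_of_pos (h.trans_le h1) _
  have h4 : -z * (1 + a * z) ^ (-(4 : ℝ) / 3) ≤ -y * (1 + a * y) ^ (-(4 : ℝ) / 3) :=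
    mul_le_mul (by linarith) h2 h3.le (by linarith)
  have h5 : 0 ≤ 2 / 9 * a ^ 2 := by positivity
  linarith [mul_le_mul_of_nonneg_left h4 h5]

/-! ### The Cauchy horizon as a simple zero of h. -/

/-- In terms of `y = (1 + a z)^{1/3}` the function `h` is a quartic polynomial divided by `y`. -/
theorem horizonFn_cube {a y : ℝ} (ha : 0 < a) (hy : 0 < y) :
    horizonFn a ((y ^ 3 - 1) / a) = (3 * y ^ 4 + a * y ^ 3 - 3 * y + 2 * a) / (3 * a * y) := by
  have h1 : 1 + a * ((y ^ 3 - 1) / a) = y ^ 3 := by field_simp; ring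
  have h2 : 0 < 1 + a * ((y ^ 3 - 1) / a) := by rw [h1]; positivity
  have h3 : (y ^ 3) ^ ((2 : ℝ) / 3) = y ^ 2 := by
    rw [← Real.rpow_natCast, ← Real.rpow_mul hy.le, ← Real.rpow_natCast]; norm_num
  have h4 : (y ^ 3) ^ (-(1 : ℝ) / 3) = y⁻¹ := by
    rw [← Real.rpow_natCast, ← Real.rpow_mul hy.le, ← Real.rpow_neg_one]; norm_num
  rw [horizonFn, radial1_eq_rpow h2, radial, h1, h3, h4]
  field_simp
  ring

/-- Below the critical value `a^*` the function `h` takes negative values. -/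
theorem exists_horizonFn_neg {a : ℝ} (ha : 0 < a) (ha' : a < aStar) :
    ∃ z, 0 < 1 + a * z ∧ z < 0 ∧ horizonFn a z < 0 := by
  set r : ℝ := √3 with hr
  have hr2 : r ^ 2 = 3 := Real.sq_sqrt (by norm_num)
  have hr0 : 0 ≤ r := Real.sqrt_nonneg 3
  have hr1 : 1 < r := by nlinarith
  have hr3 : r < 2 := by nlinarith
  set k : ℝ := (2 : ℝ) ^ ((1 : ℝ) / 3) with hk
  have hk0 : 0 < k := by positivity
  have hk3 : k ^ 3 = 2 := by
    rw [hk, ← Real.rpow_natCast, ← Real.rpow_mul (by norm_num)]; norm_num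
  -- By `horizonFn_cube`, h = 0 means a = 3y(1 - y³)/(y³ + 2). The right side is maximal where y⁶ +
  -- 10y³ - 2 = 0, that is y³ = 3√3 - 5, and its maximum is a^*.
  set y : ℝ := (r - 1) / k with hy
  have hy0 : 0 < y := div_pos (by linarith) hk0
  have hy3 : y ^ 3 = 3 * r - 5 := by
    rw [hy, div_pow, hk3]
    have : r ^ 3 = 3 * r := by rw [pow_succ, hr2]
    linear_combination (1 / 2) * this - 3 / 2 * hr2
  have hstar : aStar = 3 * y * (r - 1) / 2 := by
    have hpos : 0 < 2 * (26 + 15 * r) := by positivity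
    have hinv : 2 * (26 + 15 * r) = ((2 / (y * (r - 1))) : ℝ) ^ 3 := by
      rw [div_pow, mul_pow, hy3, eq_div_iff (by
        have : 0 < 3 * r - 5 := by rw [← hy3]; positivity
        have : 0 < r - 1 := by linarith
        positivity)]
      have : r ^ 3 = 3 * r := by rw [pow_succ, hr2]
      have h4 : r ^ 4 = 9 := by rw [show r ^ 4 = (r ^ 2) ^ 2 by ring, hr2]; norm_num
      have h5 : r ^ 5 = 9 * r := by rw [pow_succ, h4]
      ring_nf
      rw [h5, h4, this, hr2]
      ring
    have hq : 0 ≤ 2 / (y * (r - 1)) := by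
      have : 0 < r - 1 := by linarith
      positivity
    rw [aStar, ← hr, hinv, ← Real.rpow_natCast, ← Real.rpow_mul hq]
    have : r - 1 ≠ 0 := by linarith
    norm_num
    field_simp
  have hylt : y ^ 3 < 1 := by rw [hy3]; linarith
  refine ⟨(y ^ 3 - 1) / a, ?_, div_neg_of_neg_of_pos (by linarith) ha, ?_⟩
  · rw [mul_div_cancel₀ _ ha.ne']; have : 0 < y ^ 3 := by positivity
    linarith
  · rw [horizonFn_cube ha hy0]
    refine div_neg_of_neg_of_pos ?_ (by positivity)
    have h1 : a * (y ^ 3 + 2) < aStar * (y ^ 3 + 2) := by gcongr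
    have h2 : aStar * (y ^ 3 + 2) = 3 * y * (1 - y ^ 3) := by
      rw [hstar, hy3]
      linear_combination (9 / 2 * y) * hr2
    nlinarith

variable {a : ℝ}

theorem one_add_mul_pos (ha : 0 < a) {z : ℝ} : 0 < 1 + a * z ↔ -1 / a < z := by
  rw [div_lt_iff₀ ha]; constructor <;> intro h <;> linarith

theorem horizonFn_zero : horizonFn a 0 = 1 := by simp [horizonFn, radial]

theorem continuousOn_horizonFn (ha : 0 < a) {y : ℝ} (hy : 0 < 1 + a * y) :
    ContinuousOn (horizonFn a) (Icc y 0) := fun x hx =>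
  (analyticAt_horizonFn (hy.trans_le (by gcongr; exact hx.1))).continuousAt.continuousWithinAt

/-- Roots exist between a point y with h(y) < 0 and 0, where h = 1. The supremum lies in [y, 0],
away from -1/a, so continuity makes it a root; a nonpositive value further right would give a larger
root. If h'(z_c) ≤ 0, convexity would make h antitone on [y, z_c], contradicting h(y) < 0 = h(z_c).
-/
theorem cauchyHorizon_spec (ha : 0 < a) (ha' : a < aStar) :
    0 < 1 + a * cauchyHorizon a ∧ cauchyHorizon a < 0 ∧ horizonFn a (cauchyHorizon a) = 0 ∧
      (∀ z, cauchyHorizon a < z → z ≤ 0 → 0 < horizonFn a z) ∧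
      0 < 1 - cauchyHorizon a * radial2 a (cauchyHorizon a) := by
  obtain ⟨y, hy1, hy0, hyn⟩ := exists_horizonFn_neg ha ha'
  set Z : Set ℝ := {z : ℝ | -1 / a < z ∧ z < 0 ∧ horizonFn a z = 0} with hZ
  have hroot : ∀ x, y ≤ x → x < 0 → horizonFn a x ≤ 0 → ∃ z, x ≤ z ∧ z ∈ Z := by
    intro x hyx hx0 hxn
    have hx1 : 0 < 1 + a * x := hy1.trans_le (by gcongr)
    obtain ⟨z, hz, hz0⟩ := intermediate_value_Icc hx0.le (continuousOn_horizonFn ha hx1)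
      (show (0 : ℝ) ∈ Icc _ _ by rw [horizonFn_zero]; exact ⟨hxn, zero_le_one⟩)
    refine ⟨z, hz.1, (one_add_mul_pos ha).1 (hx1.trans_le (by gcongr; exact hz.1)),
      hz.2.lt_of_ne ?_, hz0⟩
    rintro rfl
    rw [horizonFn_zero] at hz0
    exact one_ne_zero hz0
  have hbdd : BddAbove Z := ⟨0, fun z hz => hz.2.1.le⟩
  obtain ⟨z₁, hyz₁, hz₁⟩ := hroot y le_rfl hy0 hyn.le
  have hyc : y ≤ cauchyHorizon a := hyz₁.trans (le_csSup hbdd hz₁)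
  have hc1 : 0 < 1 + a * cauchyHorizon a := hy1.trans_le (by gcongr)
  have hcle : cauchyHorizon a ≤ 0 := csSup_le ⟨z₁, hz₁⟩ fun z hz => hz.2.1.le
  have hzero : horizonFn a (cauchyHorizon a) = 0 := by
    have hcl : cauchyHorizon a ∈ closure Z := csSup_mem_closure ⟨z₁, hz₁⟩ hbdd
    obtain ⟨x, hxZ, hx⟩ := mem_closure_iff_seq_limit.1 hcl
    have h1 := (analyticAt_horizonFn hc1).continuousAt.tendsto.comp hx
    have h2 : horizonFn a ∘ x = fun _ => 0 := funext fun n => (hxZ n).2.2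
    rw [h2] at h1
    exact tendsto_nhds_unique h1 tendsto_const_nhds
  have hc0 : cauchyHorizon a < 0 := by
    refine hcle.lt_of_ne fun h => ?_
    rw [h, horizonFn_zero] at hzero
    exact one_ne_zero hzero
  refine ⟨hc1, hc0, hzero, ?_, ?_⟩
  · intro z hz hz0
    by_contra! hn
    rcases hz0.lt_or_eq with hz0 | rfl
    · obtain ⟨x, hzx, hx⟩ := hroot z (hyc.trans hz.le) hz0 hn
      exact absurd (le_csSup hbdd hx) (not_le.2 (hz.trans_le hzx))
    · rw [horizonFn_zero] at hn; linarith
  · by_contra! hn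
    have hanti : AntitoneOn (horizonFn a) (Icc y (cauchyHorizon a)) := by
      have hI : ∀ x ∈ Icc y (cauchyHorizon a), 0 < 1 + a * x := fun x hx =>
        hy1.trans_le (by gcongr; exact hx.1)
      refine antitoneOn_of_deriv_nonpos (convex_Icc _ _)
        ((continuousOn_horizonFn ha hy1).mono (Icc_subset_Icc_right hcle)) ?_ ?_
      · intro x hx
        rw [interior_Icc] at hx
        exact (hasDerivAt_horizonFn
          (hI x (Ioo_subset_Icc_self hx))).differentiableAt.differentiableWithinAt
      · intro x hx
        rw [interior_Icc] at hx
        have hx1 := hI x (Ioo_subset_Icc_self hx)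
        rw [(hasDerivAt_horizonFn hx1).deriv]
        exact (deriv_horizonFn_monotone hx1 ha hx.2.le hcle).trans hn
    have := hanti ⟨le_rfl, hyc⟩ ⟨hyc, le_rfl⟩ hyc
    linarith

/-- At the horizon h = 0 reads S = -z_c (1 - S'), and S > 0 > z_c forces S' < 1; further right S' is
smaller. -/
theorem radial1_lt_one (ha : 0 < a) (ha' : a < aStar) {z : ℝ} (hz : cauchyHorizon a ≤ z) :
    radial1 a z < 1 := by
  obtain ⟨h1, h0, hz0, -⟩ := cauchyHorizon_spec ha ha'
  refine (radial1_antitone ha h1 hz).trans_lt ?_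
  have h2 := radial_pos h1
  rw [horizonFn] at hz0
  nlinarith

/-! ### Regularity of the coefficients; only the fifth row (index 4) has h in a denominator, apart
from the transport speed. -/

/-- The facts about the background functions that make the coefficients regular. -/
structure IsRegularPoint (a z : ℝ) : Prop where
  z_ne : z ≠ 0
  S_ne : radial a z ≠ 0
  S1_sub_ne : -1 + radial1 a z ≠ 0
  S1_add_ne : 1 + radial1 a z ≠ 0
  q_ne : density a z ≠ 0
  sub_ne : radial a z - z * radial1 a z ≠ 0
  in_ne : z - radial a z + z * radial1 a z ≠ 0
  S_an : AnalyticAt ℝ (radial a) z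
  S1_an : AnalyticAt ℝ (radial1 a) z
  S2_an : AnalyticAt ℝ (radial2 a) z
  S3_an : AnalyticAt ℝ (radial3 a) z
  q_an : AnalyticAt ℝ (density a) z
  q1_an : AnalyticAt ℝ (deriv (density a)) z
  h_an : AnalyticAt ℝ (horizonFn a) z

theorem isRegularPoint (ha : 0 < a) (ha' : a < aStar) {z : ℝ} (hz : cauchyHorizon a ≤ z)
    (hz0 : z < 0) : IsRegularPoint a z := by
  have hp : 0 < 1 + a * z := (cauchyHorizon_spec ha ha').1.trans_le (by gcongr)
  have hS := radial_pos hp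
  have hS1 := radial1_pos ha hp
  have hlt := radial1_lt_one ha ha' hz
  have hden : 0 < 3 + 4 * a * z + a ^ 2 * z ^ 2 := by
    have : 0 < (1 + a * z) * (3 + a * z) := mul_pos hp (by linarith)
    linarith
  have hq : AnalyticAt ℝ (density a) z := by
    unfold density
    fun_prop (disch := positivity)
  have hz1 : z * radial1 a z < 0 := mul_neg_of_neg_of_pos hz0 hS1
  exact ⟨hz0.ne, hS.ne', by linarith, by linarith,
    by unfold density; positivity, by linarith, by linarith,
    analyticAt_radial hp, analyticAt_radial1 hp, analyticAt_radial2 hp, analyticAt_radial3 hp,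
    hq, hq.deriv, analyticAt_horizonFn hp⟩

theorem IsRegularPoint.continuousAt_cTilde {z : ℝ} (h : IsRegularPoint a z) (l : ℕ) (i j : Fin 5)
    (hi : i ≠ 4) : ContinuousAt (fun z => cTilde a l z i j) z := by
  obtain ⟨h1, h2, h3, h4, h5, h6, h7, c0, c1, c2, c3, c4, c5, -⟩ := h
  replace c0 := c0.continuousAt
  replace c1 := c1.continuousAt
  replace c2 := c2.continuousAt
  replace c3 := c3.continuousAt
  replace c4 := c4.continuousAt
  replace c5 := c5.continuousAt
  fin_cases i <;> first | exact absurd rfl hi | skip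
  all_goals
    fin_cases j <;> simp only [cTilde, Matrix.of_apply, Matrix.cons_val', Matrix.cons_val,
      Fin.reduceFinMk, Fin.zero_eta, Fin.mk_one, Fin.isValue] <;>
    fun_prop (disch := simp [h1, h2, h3, h4, h6, h7])

theorem IsRegularPoint.continuousAt_sourceTilde {z : ℝ} (h : IsRegularPoint a z) (i : Fin 5)
    (hi : i ≠ 4) : ContinuousAt (fun z => sourceTilde a z i) z := by
  obtain ⟨h1, h2, h3, h4, h5, h6, h7, c0, c1, c2, c3, c4, c5, -⟩ := h
  replace c0 := c0.continuousAt
  replace c1 := c1.continuousAt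
  replace c4 := c4.continuousAt
  fin_cases i <;> first | exact absurd rfl hi | skip
  all_goals
    simp only [sourceTilde, Matrix.cons_val,
      Fin.reduceFinMk, Fin.zero_eta, Fin.mk_one, Fin.isValue]
    fun_prop (disch := simp [h1, h2, h7])

theorem IsRegularPoint.continuousAt_aTilde {z : ℝ} (h : IsRegularPoint a z)
    (hh : horizonFn a z ≠ 0) (i : Fin 5) : ContinuousAt (fun z => aTilde a z i) z := by
  obtain ⟨h1, h2, h3, h4, h5, h6, h7, c0, c1, c2, c3, c4, c5, -⟩ := h
  replace c0 := c0.continuousAt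
  replace c1 := c1.continuousAt
  rw [horizonFn] at hh
  fin_cases i
  all_goals
    simp only [aTilde, Matrix.cons_val,
      Fin.reduceFinMk, Fin.zero_eta, Fin.mk_one, Fin.isValue]
    fun_prop (disch := simp [h1, h7, hh])

/-- The fifth row of the matrix `C̃` and of the source, multiplied by `h`. -/
noncomputable def lastRow (a z : ℝ) : Fin 5 → ℝ :=
  ![-(4 * (-z * radial1 a z ^ 2 + radial a z * (radial1 a z + z * radial2 a z)) / radial a z),
    0,
    -((-1 + radial1 a z) * (radial a z - z * radial1 a z) / radial a z),
    -((-1 + radial1 a z) * (radial a z - z * radial1 a z) / radial a z),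
    (3 + (-z + radial a z) * radial2 a z + radial1 a z * (-3 + z * radial2 a z))
      / (1 - radial1 a z)]

noncomputable def lastSource (a z : ℝ) : ℝ :=
  8 * Real.pi * density a z * (-1 + radial1 a z) * (radial a z - z * radial1 a z) / radial a z

theorem cTilde_four (a : ℝ) (l : ℕ) (z : ℝ) (j : Fin 5) :
    cTilde a l z 4 j = lastRow a z j / horizonFn a z := by
  fin_cases j
  all_goals
    simp only [cTilde, lastRow, horizonFn, Matrix.of_apply, Matrix.cons_val', Matrix.cons_val,
      Fin.reduceFinMk, Fin.zero_eta, Fin.mk_one, Fin.isValue, neg_div, div_div, zero_div]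
  rw [← div_neg]
  congr 1
  ring

theorem sourceTilde_four (a z : ℝ) : sourceTilde a z 4 = lastSource a z / horizonFn a z := by
  simp only [sourceTilde, lastSource, horizonFn, Matrix.cons_val, Fin.isValue, div_div]

theorem IsRegularPoint.differentiableAt_lastRow {z : ℝ} (h : IsRegularPoint a z) (j : Fin 5) :
    DifferentiableAt ℝ (fun z => lastRow a z j) z := by
  have c0 := h.S_an.differentiableAt
  have c1 := h.S1_an.differentiableAt
  have c2 := h.S2_an.differentiableAt
  have h2 := h.S_ne
  have h3 : 1 - radial1 a z ≠ 0 := fun h' => h.S1_sub_ne (by linarith)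
  fin_cases j
  all_goals
    simp only [lastRow, Matrix.cons_val, Fin.reduceFinMk, Fin.zero_eta, Fin.mk_one, Fin.isValue]
    fun_prop (disch := first | exact h2 | exact h3)

theorem IsRegularPoint.continuousAt_lastSource {z : ℝ} (h : IsRegularPoint a z) :
    ContinuousAt (lastSource a) z := by
  have c0 := h.S_an.continuousAt
  have c1 := h.S1_an.continuousAt
  have c2 := h.q_an.continuousAt
  have h2 := h.S_ne
  unfold lastSource
  fun_prop (disch := exact h2)

/-! ### Division by the simple zero of h, and the exponent c. -/

/-- The function `h(z) / (z - z_c)`, extended to `z = z_c`. -/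
noncomputable def horizonQuot (a : ℝ) : ℝ → ℝ := dslope (horizonFn a) (cauchyHorizon a)

theorem horizonQuot_mul (ha : 0 < a) (ha' : a < aStar) (s : ℝ) :
    s * horizonQuot a (cauchyHorizon a + s) = horizonFn a (cauchyHorizon a + s) := by
  have := sub_smul_dslope (horizonFn a) (cauchyHorizon a) (cauchyHorizon a + s)
  rw [(cauchyHorizon_spec ha ha').2.2.1, add_sub_cancel_left, sub_zero, smul_eq_mul] at this
  exact this

theorem horizonQuot_self (ha : 0 < a) (ha' : a < aStar) :
    horizonQuot a (cauchyHorizon a) = 1 - cauchyHorizon a * radial2 a (cauchyHorizon a) := by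
  rw [horizonQuot, dslope_same, (hasDerivAt_horizonFn (cauchyHorizon_spec ha ha').1).deriv]

theorem horizonQuot_pos (ha : 0 < a) (ha' : a < aStar) {z : ℝ} (hz : cauchyHorizon a ≤ z)
    (hz0 : z ≤ 0) : 0 < horizonQuot a z := by
  obtain ⟨-, -, -, h4, h5⟩ := cauchyHorizon_spec ha ha'
  rcases hz.lt_or_eq with hz | rfl
  · have h1 := horizonQuot_mul ha ha' (z - cauchyHorizon a)
    rw [add_sub_cancel] at h1
    have h2 := h4 z hz hz0
    rw [← h1] at h2
    exact pos_of_mul_pos_right h2 (sub_pos.2 hz).le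
  · rwa [horizonQuot_self ha ha']

/-- The difference quotient of an analytic function is analytic. Differentiability, beyond
continuity, is needed to make the (5,5) entry c/t + O(1). -/
theorem differentiableAt_horizonQuot_self (ha : 0 < a) (ha' : a < aStar) :
    DifferentiableAt ℝ (horizonQuot a) (cauchyHorizon a) := by
  obtain ⟨p, hp⟩ := analyticAt_horizonFn (cauchyHorizon_spec ha ha').1
  exact hp.has_fpower_series_dslope_fslope.analyticAt.differentiableAt

theorem differentiableAt_horizonQuot (ha : 0 < a) (ha' : a < aStar) {z : ℝ}
    (hz : cauchyHorizon a ≤ z) (hz0 : z < 0) : DifferentiableAt ℝ (horizonQuot a) z := by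
  rcases hz.lt_or_eq with h | rfl
  · exact (differentiableAt_dslope_of_ne h.ne').2
      (isRegularPoint ha ha' hz hz0).h_an.differentiableAt
  · exact differentiableAt_horizonQuot_self ha ha'

/-- The fifth row of `C(t)` as a function of `z`, regular up to the Cauchy horizon. -/
noncomputable def lastRowQuot (a : ℝ) (j : Fin 5) (z : ℝ) : ℝ := lastRow a z j / horizonQuot a z

theorem differentiableAt_lastRowQuot (ha : 0 < a) (ha' : a < aStar) {z : ℝ}
    (hz : cauchyHorizon a ≤ z) (hz0 : z < 0) (j : Fin 5) :
    DifferentiableAt ℝ (lastRowQuot a j) z :=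
  ((isRegularPoint ha ha' hz hz0).differentiableAt_lastRow j).div
    (differentiableAt_horizonQuot ha ha' hz hz0) (horizonQuot_pos ha ha' hz hz0.le).ne'

theorem exponent_eq (ha : 0 < a) (ha' : a < aStar) :
    exponent a = lastRowQuot a 4 (cauchyHorizon a) := by
  have h0 := (cauchyHorizon_spec ha ha').2.1
  refine Tendsto.limUnder_eq ?_
  have h1 : Tendsto (fun t => lastRowQuot a 4 (cauchyHorizon a + t)) (𝓝[>] 0)
      (𝓝 (lastRowQuot a 4 (cauchyHorizon a))) := by
    refine (differentiableAt_lastRowQuot ha ha' le_rfl h0 4).continuousAt.tendsto.comp ?_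
    have : Tendsto (fun t : ℝ => cauchyHorizon a + t) (𝓝 0) (𝓝 (cauchyHorizon a + 0)) :=
      Continuous.tendsto (by fun_prop) 0
    rw [add_zero] at this
    exact this.mono_left nhdsWithin_le_nhds
  refine h1.congr' ?_
  filter_upwards [self_mem_nhdsWithin] with t ht
  have ht : t ≠ 0 := ne_of_gt ht
  change _ = t * (_ / ((1 - radial1 a (cauchyHorizon a + t)) * horizonFn a (cauchyHorizon a + t)))
  rw [← horizonQuot_mul ha ha', lastRowQuot]
  simp only [lastRow, Matrix.cons_val, Fin.isValue]
  rw [← mul_div_assoc, mul_left_comm, mul_div_mul_left _ _ ht, div_div]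
  congr 1
  ring

/-- With S = -z_c (1 - S') the numerator of the (5,5) entry factors as (1 - S')(3 - 2 z_c S''), and
z_c S'' < 1 because the zero of h is simple. -/
theorem exponent_pos (ha : 0 < a) (ha' : a < aStar) : 0 < exponent a := by
  obtain ⟨-, -, h3, -, h5⟩ := cauchyHorizon_spec ha ha'
  rw [exponent_eq ha ha', lastRowQuot, horizonQuot_self ha ha']
  refine div_pos ?_ h5
  have h1 := radial1_lt_one ha ha' (le_refl (cauchyHorizon a))
  simp only [lastRow, Matrix.cons_val, Fin.isValue]
  refine div_pos ?_ (by linarith)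
  rw [horizonFn] at h3
  have h6 : 0 < (1 - radial1 a (cauchyHorizon a)) *
      (3 - 2 * (cauchyHorizon a * radial2 a (cauchyHorizon a))) :=
    mul_pos (by linarith) (by linarith)
  have h7 : radial a (cauchyHorizon a) =
      -cauchyHorizon a + cauchyHorizon a * radial1 a (cauchyHorizon a) := by linarith
  rw [h7]
  linarith

/-! ### Uniform size of the coefficients. -/

theorem exists_common_bound {ι : Type*} [Finite ι] {K : Set ℝ} (hK : IsCompact K)
    {F : ι → ℝ → ℝ} (hF : ∀ i, ∀ z ∈ K, ContinuousAt (F i) z) :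
    ∃ N, 0 ≤ N ∧ ∀ i, ∀ z ∈ K, |F i z| ≤ N := by
  choose B hB using fun i => hK.exists_bound_of_continuousOn
    (fun z hz => (hF i z hz).continuousWithinAt)
  obtain ⟨N, hN⟩ := Finite.exists_le B
  exact ⟨max N 0, le_max_right _ _, fun i z hz =>
    ((hB i z hz).trans (hN i)).trans (le_max_left _ _)⟩

/-- The size of the coefficients up to the Cauchy horizon: the first four rows are bounded, the
fifth one is singular of order `1/t`, with leading diagonal coefficient `exponent a`. -/
theorem exists_coeff_bound (ha : 0 < a) (ha' : a < aStar) (l : ℕ) {t₁ : ℝ}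
    (ht₁ : t₁ < -cauchyHorizon a) :
    ∃ N, 0 ≤ N ∧ ∀ s ∈ Ioc 0 t₁,
      (∀ i j, i ≠ 4 → |cTilde a l (cauchyHorizon a + s) i j| ≤ N) ∧
      (∀ i, i ≠ 4 → |sourceTilde a (cauchyHorizon a + s) i| ≤ N) ∧
      (∀ j, |cTilde a l (cauchyHorizon a + s) 4 j| ≤ N / s) ∧
      |cTilde a l (cauchyHorizon a + s) 4 4| ≤ exponent a / s + N ∧
      |sourceTilde a (cauchyHorizon a + s) 4| ≤ N / s := by
  set c := cauchyHorizon a with hc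
  have hc0 : c < 0 := (cauchyHorizon_spec ha ha').2.1
  have hK : IsCompact (Icc c (c + t₁)) := isCompact_Icc
  have hK0 : ∀ z ∈ Icc c (c + t₁), z < 0 := fun z hz => hz.2.trans_lt (by linarith)
  have hreg : ∀ z ∈ Icc c (c + t₁), IsRegularPoint a z := fun z hz =>
    isRegularPoint ha ha' hz.1 (hK0 z hz)
  obtain ⟨N₁, hN₁, h₁⟩ := exists_common_bound hK
    (F := fun (x : {i : Fin 5 // i ≠ 4} × Fin 5) z => cTilde a l z x.1 x.2)
    fun x z hz => (hreg z hz).continuousAt_cTilde l _ _ x.1.2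
  obtain ⟨N₂, hN₂, h₂⟩ := exists_common_bound hK
    (F := fun (x : {i : Fin 5 // i ≠ 4}) z => sourceTilde a z x)
    fun x z hz => (hreg z hz).continuousAt_sourceTilde _ x.2
  obtain ⟨N₃, hN₃, h₃⟩ := exists_common_bound hK (F := lastRowQuot a)
    fun j z hz => (differentiableAt_lastRowQuot ha ha' hz.1 (hK0 z hz) j).continuousAt
  obtain ⟨N₄, hN₄, h₄⟩ := exists_common_bound hK
    (F := fun (_ : Unit) z => lastSource a z / horizonQuot a z)
    fun _ z hz => (hreg z hz).continuousAt_lastSource.div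
      (differentiableAt_horizonQuot ha ha' hz.1 (hK0 z hz)).continuousAt
      (horizonQuot_pos ha ha' hz.1 (hK0 z hz).le).ne'
  -- The difference quotient bounds the (5,5) entry minus c/s. The leading coefficient must be
  -- exactly c, since it fixes the power of t.
  obtain ⟨N₅, hN₅, h₅⟩ := exists_common_bound hK
    (F := fun (_ : Unit) => dslope (lastRowQuot a 4) c) fun _ z hz => by
      have hd := differentiableAt_lastRowQuot ha ha' hz.1 (hK0 z hz) 4
      rcases hz.1.lt_or_eq with h | rfl
      · exact (continuousAt_dslope_of_ne h.ne').2 hd.continuousAt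
      · exact continuousAt_dslope_same.2 hd
  have hrow : ∀ s, ∀ j, cTilde a l (c + s) 4 j = lastRowQuot a j (c + s) / s := fun s j => by
    rw [cTilde_four, ← horizonQuot_mul ha ha', lastRowQuot, div_div, mul_comm]
  have hsrc : ∀ s, sourceTilde a (c + s) 4 = lastSource a (c + s) / horizonQuot a (c + s) / s :=
    fun s => by rw [sourceTilde_four, ← horizonQuot_mul ha ha', div_div, mul_comm]
  refine ⟨N₁ + N₂ + N₃ + N₄ + N₅, by positivity, fun s hs => ?_⟩
  have hs0 : 0 < s := hs.1
  have hsK : c + s ∈ Icc c (c + t₁) := ⟨by linarith, by linarith [hs.2]⟩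
  refine ⟨fun i j hi => ?_, fun i hi => ?_, fun j => ?_, ?_, ?_⟩
  · linarith [h₁ (⟨i, hi⟩, j) _ hsK]
  · linarith [h₂ ⟨i, hi⟩ _ hsK]
  · rw [hrow, abs_div, abs_of_pos hs0]
    gcongr
    linarith [h₃ j _ hsK]
  · have h6 := sub_smul_dslope (lastRowQuot a 4) c (c + s)
    rw [add_sub_cancel_left, smul_eq_mul, ← exponent_eq ha ha'] at h6
    have h7 : cTilde a l (c + s) 4 4 = exponent a / s + dslope (lastRowQuot a 4) c (c + s) := by
      rw [hrow]
      field_simp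
      linarith
    rw [h7]
    refine (abs_add_le _ _).trans ?_
    rw [abs_of_pos (div_pos (exponent_pos ha ha') hs0)]
    linarith [h₅ () _ hsK]
  · rw [hsrc, abs_div, abs_of_pos hs0]
    gcongr
    linarith [h₄ () _ hsK]

/-! ### Characteristics and barrier functions. -/

/-- Along the characteristic direction a solution satisfies an ordinary differential equation. -/
theorem IsSolution.hasDerivAt_characteristic {a : ℝ} {l : ℕ} {t₁ : ℝ} {g : ℝ → ℝ}
    {f : ℝ → Fin 5 → ℝ} {u : ℝ → ℝ → Fin 5 → ℝ} (hu : IsSolution a l t₁ g f u) {s : ℝ}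
    (hs : s ∈ Ioo 0 t₁) (p : ℝ) (i : Fin 5) :
    HasDerivAt (fun τ => u (s + τ) (p + τ * aTilde a (cauchyHorizon a + s) i) i)
      (g p * sourceTilde a (cauchyHorizon a + s) i -
        ∑ j, cTilde a l (cauchyHorizon a + s) i j * u s p j) 0 := by
  set k := aTilde a (cauchyHorizon a + s) i with hk
  have hnt : Ioc 0 t₁ ∈ 𝓝 s := Ioc_mem_nhds hs.1 hs.2
  have hn : Ioc 0 t₁ ×ˢ univ ∈ 𝓝 (s, p) := prod_mem_nhds hnt univ_mem
  have hd : DifferentiableAt ℝ (fun y : ℝ × ℝ => u y.1 y.2) (s, p) :=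
    (hu.smooth.contDiffAt hn).differentiableAt (by simp)
  set F := fderiv ℝ (fun y : ℝ × ℝ => u y.1 y.2) (s, p) with hF
  have hF' : HasFDerivAt (fun y : ℝ × ℝ => u y.1 y.2) F (s, p) := hd.hasFDerivAt
  have ht : HasDerivAt (fun s => u s p) (F (1, 0)) s :=
    HasFDerivAt.comp_hasDerivAt s (f := fun s => (s, p)) hF'
      ((hasDerivAt_id s).prodMk (hasDerivAt_const s p))
  have hp : HasDerivAt (fun r => u s r) (F (0, 1)) p :=
    HasFDerivAt.comp_hasDerivAt p (f := fun r => (s, r)) hF'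
      ((hasDerivAt_const p s).prodMk (hasDerivAt_id p))
  have hline : HasDerivAt (fun τ : ℝ => (s + τ, p + τ * k)) (1, k) 0 := by
    refine ((hasDerivAt_id (0 : ℝ)).const_add s).prodMk ?_
    simpa using ((hasDerivAt_id (0 : ℝ)).mul_const k).const_add p
  have hF0 : HasFDerivAt (fun y : ℝ × ℝ => u y.1 y.2) F (s + 0, p + 0 * k) := by
    rwa [add_zero, zero_mul, add_zero]
  have hc : HasDerivAt (fun τ => u (s + τ) (p + τ * k)) (F (1, k)) 0 :=
    HasFDerivAt.comp_hasDerivAt (0 : ℝ) (f := fun τ : ℝ => (s + τ, p + τ * k)) hF0 hline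
  refine (hasDerivAt_pi.1 hc i).congr_deriv ?_
  have hsplit : F (1, k) = F (1, 0) + k • F (0, 1) := by
    rw [← map_smul, ← map_add]; simp
  have he := congrFun (hu.eqn s ⟨hs.1, hs.2.le⟩ p) i
  rw [derivWithin_of_mem_nhds hnt, ht.deriv, hp.deriv] at he
  simp only [coeffA, coeffC, source, Matrix.smul_mulVec, Matrix.mulVec_diagonal, Pi.add_apply,
    Pi.smul_apply, smul_eq_mul] at he
  rw [← hk] at he
  simp only [Matrix.mulVec, dotProduct] at he
  rw [hsplit, Pi.add_apply, Pi.smul_apply, smul_eq_mul]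
  apply mul_left_cancel₀ hs.1.ne'
  linear_combination he

/-- The exponents of the barrier functions, relative to `t^{-c}`. -/
noncomputable def extraExponent (i : Fin 5) : ℝ := if i = 4 then 1 / 2 else 0

/-- The barrier functions. -/
noncomputable def barrier (B m c s : ℝ) (i : Fin 5) : ℝ :=
  B * Real.exp (-(m * s)) * s ^ (-(c + extraExponent i))

theorem hasDerivAt_barrier (B m c : ℝ) {s : ℝ} (hs : 0 < s) (i : Fin 5) :
    HasDerivAt (fun s => barrier B m c s i)
      (-((m + (c + extraExponent i) / s) * barrier B m c s i)) s := by
  have h1 : HasDerivAt (fun s : ℝ => -(m * s)) (-m) s :=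
    HasDerivAt.congr_deriv ((hasDerivAt_id s).const_mul m).neg (by simp)
  have h2 := ((h1.exp.const_mul B).mul
    (Real.hasDerivAt_rpow_const (p := -(c + extraExponent i)) (Or.inl hs.ne')))
  refine h2.congr_deriv ?_
  rw [barrier, Real.rpow_sub_one hs.ne']
  field_simp
  ring

/-- The algebraic inequalities that make the barrier functions strict supersolutions. -/
theorem barrier_strict {N c G m s v : ℝ} (hN : 0 ≤ N) (hc : 0 < c) (hG : 0 ≤ G)
    (hv : 1 ≤ v)
    (hm : m = N * (4 + G) + N ^ 2 / (4 * c) + N + N ^ 2 * (4 + G) ^ 2 / 2 + 1)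
    {r : ℝ} (hr0 : 0 < r) (hr : r ^ 2 = 1 / s) :
    N * (4 * v + v * r) + G * N < (m + c / s) * v ∧
    4 * (N / s * v) + (c / s + N) * (v * r) + G * (N / s) < (m + (c + 1 / 2) / s) * (v * r) := by
  have h0 : ∀ x, x / s = x * r ^ 2 := fun x => by rw [hr]; ring
  rw [h0, h0, h0]
  have hv0 : 0 < v := by linarith
  have hcc : 0 ≤ N ^ 2 / (4 * c) := by positivity
  have hGG : 0 ≤ N ^ 2 * (4 + G) ^ 2 / 2 := by positivity
  have hNG : 0 ≤ N * (4 + G) := by positivity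
  have hGN : 0 ≤ G * N := by positivity
  constructor
  -- Here r = s^{-1/2} is the ratio of the fifth barrier to the others. Completing the square
  -- absorbs the coupling N r into c r².
  · have h1 : N * r ≤ N ^ 2 / (4 * c) + c * r ^ 2 := by
      have : N ^ 2 / (4 * c) + c * r ^ 2 - N * r = (N - 2 * c * r) ^ 2 / (4 * c) := by
        field_simp; ring
      have : 0 ≤ (N - 2 * c * r) ^ 2 / (4 * c) := by positivity
      linarith
    have h2 : G * N ≤ G * N * v := le_mul_of_one_le_right hGN hv
    have h3 : N * (4 + G) + N * r < m + c * r ^ 2 := by linarith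
    have h4 := mul_lt_mul_of_pos_right h3 hv0
    linarith
  -- After division by v r, the other components and the source contribute at most N(4 + G) r; the
  -- extra exponent 1/2 supplies the r²/2 that absorbs it.
  · have h1 : N * (4 + G) * r ≤ N ^ 2 * (4 + G) ^ 2 / 2 + r ^ 2 / 2 := by
      linarith [sq_nonneg (N * (4 + G) - r)]
    have h2 : G * (N * r ^ 2) ≤ G * (N * r ^ 2) * v :=
      le_mul_of_one_le_right (by positivity) hv
    have h3 : N * (4 + G) * r + N + c * r ^ 2 < m + (c + 1 / 2) * r ^ 2 := by linarith
    have h4 := mul_lt_mul_of_pos_right h3 (mul_pos hv0 hr0)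
    linarith

end LTB

/-! ### Choice of constants and conclusion. -/

open LTB in
theorem mainTheorem8 (a : ℝ) (ha : 0 < a) (ha' : a < LTB.aStar) (l : ℕ)
    (t₁ : ℝ) (ht₁ : 0 < t₁) (ht₁' : t₁ < -LTB.cauchyHorizon a)
    (f : ℝ → Fin 5 → ℝ) (hf : ContDiff ℝ ∞ f) (hf' : HasCompactSupport f)
    (g : ℝ → ℝ) (hg : ContDiff ℝ ∞ g) (hg' : HasCompactSupport g) :
    ∃ β : Fin 5 → ℝ, ∀ u : ℝ → ℝ → Fin 5 → ℝ, LTB.IsSolution a l t₁ g f u →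
      ∀ t ∈ Ioc 0 t₁, ∀ p : ℝ,
        (∀ i : Fin 4, |LTB.rescaled a u t p i.castSucc| ≤ β i.castSucc) ∧
        |t ^ ((1 : ℝ) / 2) * LTB.rescaled a u t p 4| ≤ β 4 := by
  obtain ⟨N, hN, hcoef⟩ := exists_coeff_bound ha ha' l ht₁'
  obtain ⟨F₀, hF₀⟩ := hf'.exists_bound_of_continuous hf.continuous
  obtain ⟨G₀, hG₀⟩ := hg'.exists_bound_of_continuous hg.continuous
  have hFnn : 0 ≤ F₀ := (norm_nonneg _).trans (hF₀ 0)
  have hGnn : 0 ≤ G₀ := (norm_nonneg _).trans (hG₀ 0)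
  have hc := exponent_pos ha ha'
  set c := exponent a with hcdef
  obtain ⟨m, hm⟩ : ∃ m, m = N * (4 + G₀) + N ^ 2 / (4 * c) + N + N ^ 2 * (4 + G₀) ^ 2 / 2 + 1 :=
    ⟨_, rfl⟩
  have hm0 : 0 ≤ m := by rw [hm]; positivity
  -- The first summand makes the barriers of the first four components at least 1 on (0, t₁], so
  -- that they dominate the source; the other two make the barriers exceed the data at t₁ for either
  -- exponent.
  set B₀ : ℝ := t₁ ^ c + (F₀ + 1) * t₁ ^ c + (F₀ + 1) * t₁ ^ (c + 1 / 2) with hB₀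
  have hp1 : 0 < t₁ ^ c := Real.rpow_pos_of_pos ht₁ _
  have hp2 : 0 < t₁ ^ (c + 1 / 2) := Real.rpow_pos_of_pos ht₁ _
  have hB₀pos : 0 < B₀ := by positivity
  set B : ℝ := B₀ * Real.exp (m * t₁) with hB
  have hBpos : 0 < B := by positivity
  have hne : ∀ i : Fin 5, i ≠ 4 → extraExponent i = 0 := fun i hi => if_neg hi
  have h4 : extraExponent 4 = 1 / 2 := if_pos rfl
  have hinit : ∀ i, F₀ < barrier B m c t₁ i := by
    intro i
    have h1 : barrier B m c t₁ i = B₀ / t₁ ^ (c + extraExponent i) := by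
      rw [barrier, hB, mul_assoc B₀, ← Real.exp_add, Real.rpow_neg ht₁.le]
      simp [div_eq_mul_inv]
    rw [h1, lt_div_iff₀ (Real.rpow_pos_of_pos ht₁ _)]
    have h2 : 0 ≤ F₀ * t₁ ^ c := by positivity
    have h3 : 0 ≤ F₀ * t₁ ^ (c + 1 / 2) := by positivity
    by_cases hi : i = 4
    · rw [hi, h4, hB₀]; linarith
    · rw [hne i hi, add_zero, hB₀]; linarith
  have hbound : ∀ u : ℝ → ℝ → Fin 5 → ℝ, LTB.IsSolution a l t₁ g f u →
      ∀ t ∈ Ioc 0 t₁, ∀ p : ℝ, ∀ i, |u t p i| < barrier B m c t i := by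
    intro u hu t ht p i
    have hsub : Icc t t₁ ⊆ Ioc 0 t₁ := fun s hs => ⟨ht.1.trans_le hs.1, hs.2⟩
    -- The speed bound M depends on t, as -1/h is unbounded near the horizon, but the resulting
    -- estimate does not involve M.
    obtain ⟨M, -, hM⟩ := exists_common_bound
      (isCompact_Icc (a := cauchyHorizon a + t) (b := cauchyHorizon a + t₁))
      (F := fun i z => aTilde a z i) fun i z hz => by
        have hz0 : z < 0 := by linarith [hz.2]
        have hzc : cauchyHorizon a < z := by linarith [hz.1, ht.1]
        exact (isRegularPoint ha ha' hzc.le hz0).continuousAt_aTilde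
          ((cauchyHorizon_spec ha ha').2.2.2.1 z hzc hz0.le).ne' i
    refine abs_lt_of_strict_supersolution
      (b := fun s => aTilde a (cauchyHorizon a + s))
      (C := fun s => cTilde a l (cauchyHorizon a + s))
      (src := fun s p i => g p * sourceTilde a (cauchyHorizon a + s) i)
      (w := barrier B m c)
      (w' := fun s i => -((m + (c + extraExponent i) / s) * barrier B m c s i))
      (M := M) ht.2 ?_ ?_ ?_ ?_ ?_ ?_ p i
    · intro i
      exact (continuous_apply i).comp_continuousOn
        (hu.smooth.continuousOn.mono (prod_mono hsub subset_rfl))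
    · intro s hs i
      exact hM i _ ⟨by linarith [hs.1], by linarith [hs.2]⟩
    · intro s hs p i
      exact hu.hasDerivAt_characteristic ⟨ht.1.trans_le hs.1, hs.2⟩ p i
    · intro s hs i
      exact hasDerivAt_barrier B m c (ht.1.trans_le hs.1) i
    · intro s hs p i
      have hs0 : 0 < s := ht.1.trans_le hs.1
      obtain ⟨k1, k2, k3, k4, k5⟩ := hcoef s ⟨hs0, hs.2.le⟩
      set r : ℝ := s ^ (-(1 / 2) : ℝ) with hr
      have hr0 : 0 < r := Real.rpow_pos_of_pos hs0 _
      have hr2 : r ^ 2 = 1 / s := by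
        rw [hr, ← Real.rpow_natCast, ← Real.rpow_mul hs0.le,
          show (-(1 / 2) : ℝ) * ((2 : ℕ) : ℝ) = -1 by norm_num, Real.rpow_neg_one, one_div]
      set v : ℝ := B * Real.exp (-(m * s)) * s ^ (-c) with hvdef
      have hw : ∀ j, j ≠ 4 → barrier B m c s j = v := fun j hj => by
        rw [barrier, hne j hj, add_zero]
      have hw4 : barrier B m c s 4 = v * r := by
        rw [barrier, h4, neg_add, Real.rpow_add hs0, ← mul_assoc]
      have hv : 1 ≤ v := by
        have e1 : 1 ≤ Real.exp (m * t₁ + -(m * s)) :=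
          Real.one_le_exp (by
            have := mul_le_mul_of_nonneg_left hs.2.le hm0
            linarith)
        have e2 : t₁ ^ c ≤ B₀ := by
          have : 0 ≤ (F₀ + 1) * t₁ ^ c + (F₀ + 1) * t₁ ^ (c + 1 / 2) := by positivity
          linarith
        have e3 : s ^ c ≤ t₁ ^ c := Real.rpow_le_rpow hs0.le hs.2.le hc.le
        have e4 : 0 < s ^ c := Real.rpow_pos_of_pos hs0 _
        have e5 : v = B₀ * Real.exp (m * t₁ + -(m * s)) / s ^ c := by
          rw [hvdef, hB, Real.exp_add, Real.rpow_neg hs0.le]; ring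
        rw [e5, le_div_iff₀ e4, one_mul]
        exact (e3.trans e2).trans (le_mul_of_one_le_right hB₀pos.le e1)
      have hv0 : 0 ≤ v := by linarith
      have hvr : 0 ≤ v * r := by positivity
      obtain ⟨b1, b2⟩ := barrier_strict hN hc hGnn hv hm hr0 hr2
      simp only [Fin.sum_univ_five, neg_neg, abs_mul]
      rw [hw 0 (by decide), hw 1 (by decide), hw 2 (by decide), hw 3 (by decide), hw4]
      have hgp : |g p| ≤ G₀ := hG₀ p
      by_cases hi : i = 4
      · subst hi
        rw [h4, hw4]
        have q := fun j => mul_le_mul_of_nonneg_right (k3 j) hv0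
        have q4 := mul_le_mul_of_nonneg_right k4 hvr
        have qs := mul_le_mul hgp k5 (abs_nonneg _) hGnn
        linarith [q 0, q 1, q 2, q 3]
      · rw [hne i hi, hw i hi, add_zero]
        have q := fun j => mul_le_mul_of_nonneg_right (k1 i j hi) hv0
        have q4 := mul_le_mul_of_nonneg_right (k1 i 4 hi) hvr
        have qs := mul_le_mul hgp (k2 i hi) (abs_nonneg _) hGnn
        linarith [q 0, q 1, q 2, q 3]
    · intro p i
      rw [hu.init p]
      exact ((norm_le_pi_norm (f p) i).trans (hF₀ p)).trans_lt (hinit i)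
  have hresc : ∀ t ∈ Ioc 0 t₁, ∀ i, t ^ (c + extraExponent i) * barrier B m c t i ≤ B := by
    intro t ht i
    have hpos : 0 < t ^ (c + extraExponent i) := Real.rpow_pos_of_pos ht.1 _
    rw [barrier, Real.rpow_neg ht.1.le, mul_comm, mul_assoc, inv_mul_cancel₀ hpos.ne', mul_one]
    refine mul_le_of_le_one_right hBpos.le (Real.exp_le_one_iff.2 ?_)
    have := mul_nonneg hm0 ht.1.le
    linarith
  refine ⟨fun _ => B, fun u hu t ht p => ⟨fun i => ?_, ?_⟩⟩
  · have hi : i.castSucc ≠ 4 := Fin.castSucc_ne_last i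
    have h1 := hresc t ht i.castSucc
    rw [hne _ hi, add_zero] at h1
    rw [rescaled, Pi.smul_apply, smul_eq_mul, abs_mul, abs_of_pos (Real.rpow_pos_of_pos ht.1 _)]
    exact (mul_le_mul_of_nonneg_left (hbound u hu t ht p _).le
      (Real.rpow_nonneg ht.1.le _)).trans h1
  · have h1 := hresc t ht 4
    rw [h4] at h1
    rw [rescaled, Pi.smul_apply, smul_eq_mul, ← mul_assoc, ← Real.rpow_add ht.1, add_comm,
      abs_mul, abs_of_pos (Real.rpow_pos_of_pos ht.1 _)]
    exact (mul_le_mul_of_nonneg_left (hbound u hu t ht p _).le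
      (Real.rpow_nonneg ht.1.le _)).trans h1
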